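/- Let $A$ be a unital C*-algebra and let $l_2(A)=\{a=(a_i)_{i\in\mathbb N}\subset A:\ \sum_i a_ia_i^*\ \text{converges in norm}\}$ be the standard Hilbert $A$-module, with inner product $\langle a,b\rangle=\sum_i a_ib_i^*$ and norm $\|a\|=\|\langle a,a\rangle\|^{1/2}$. Let $J$ be a finite or countable index set, and let $\{x_j\}_{j\in J}$ be a standard frame of $l_2(A)$: there are constants $C,D>0$ such that for every $x\in l_2(A)$ the series $\sum_j\langle x,x_j\rangle\langle x_j,x\rangle$ converges in norm and $$C\,\langle x,x\rangle\ \le\ \sum_{j}\langle x,x_j\rangle\langle x_j,x\rangle\ \le\ D\,\langle x,x\rangle .$$ Let $D>0$ be any constant (for instance the smallest one) for which the right-hand inequality holds for all $x$; it is called an upper frame bound. An orthonormal basis of $l_2(A)$ is a family $\{f_j\}_{j\in J}$ with $\langle f_i,f_j\rangle=\delta_{ij}1_A$ whose finite $A$-linear combinations are norm-dense in $l_2(A)$. Then for every $\varepsilon>0$ there exist three orthonormal bases $\{f_j\}_{j\in J}$, $\{g_j\}_{j\in J}$, $\{h_j\}_{j\in J}$ of $l_2(A)$ such that $$x_j=\sqrt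 D\,(1+\varepsilon)\,(f_j+g_j+h_j)\qquad\text{for every } j\in J .$$ Moreover, if $D\ge 1$, then for every $\varepsilon>0$ there also exist three orthonormal bases $\{f_j\}_{j\in J}$, $\{g_j\}_{j\in J}$, $\{h_j\}_{j\in J}$ of $l_2(A)$ such that $x_j=D(1+\varepsilon)(f_j+g_j+h_j)$ for every $j\in J$. -/

import Mathlib

noncomputable section

namespace HilbertModuleFrames

section SquareSummable

variable {A : Type*} [CStarAlgebra A] [PartialOrder A] [StarOrderedRing A]

/-- Comparison test for norm-convergent series of positive elements of a C⋆-algebra. -/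
theorem summable_of_nonneg_of_le {ι : Type*} {u v : ι → A} (hu : ∀ i, 0 ≤ u i)
    (huv : ∀ i, u i ≤ v i) (hv : Summable v) : Summable u := by
  rw [summable_iff_vanishing_norm] at hv ⊢
  intro ε hε
  obtain ⟨s, hs⟩ := hv ε hε
  refine ⟨s, fun t ht => lt_of_le_of_lt ?_ (hs t ht)⟩
  exact CStarAlgebra.norm_le_norm_of_nonneg_of_le (Finset.sum_nonneg fun i _ => hu i)
    (Finset.sum_le_sum fun i _ => huv i)

/-- The sequences `a` in `A` for which `∑ a_i a_i⋆` converges in norm,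
as a left `A`-submodule of all sequences. -/
def squareSummable (A : Type*) [CStarAlgebra A] [PartialOrder A] [StarOrderedRing A] :
    Submodule A (ℕ → A) where
  carrier := {a | Summable fun i => a i * star (a i)}
  zero_mem' := by simp [summable_zero]
  add_mem' := by
    intro a b ha hb
    have h2 : Summable fun i => (2 : ℝ) • (a i * star (a i) + b i * star (b i)) :=
      (Summable.add ha hb).const_smul (2 : ℝ)
    refine summable_of_nonneg_of_le (fun i => mul_star_self_nonneg _) (fun i => ?_) h2
    have h0 : 0 ≤ (a i - b i) * star (a i - b i) := mul_star_self_nonneg _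
    have h1 : (2 : ℝ) • (a i * star (a i) + b i * star (b i))
        = (a + b) i * star ((a + b) i) + (a i - b i) * star (a i - b i) := by
      simp only [Pi.add_apply, star_add, star_sub, two_smul]
      noncomm_ring
    rw [h1]
    exact le_add_of_nonneg_right h0
  smul_mem' := by
    intro c a ha
    have h := (Summable.mul_left c ha).mul_right (star c)
    refine h.congr fun i => ?_
    simp [mul_assoc]

/-- The series defining the inner product of two square-summable sequences converges in norm. -/
theorem summable_mul_star {a b : ℕ → A} (ha : a ∈ squareSummable A) (hb : b ∈ squareSummable A) :
    Summable fun i => b i * star (a i) := by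
  have key : ∀ c : A, Summable fun i => (b i + c * a i) * star (b i + c * a i) := fun c =>
    (squareSummable A).add_mem hb ((squareSummable A).smul_mem c ha)
  have h1 := key 1
  have h2 := key (-1)
  have h3 := key (algebraMap ℂ A Complex.I)
  have h4 := key (-algebraMap ℂ A Complex.I)
  have h := ((h1.sub h2).add ((h3.sub h4).const_smul Complex.I)).const_smul (1 / 4 : ℂ)
  refine h.congr fun i => ?_
  simp only [← neg_smul, ← map_neg, ← Algebra.smul_def, one_mul, neg_mul, star_add, star_neg,
    star_smul, mul_add, add_mul, smul_add, smul_sub, smul_mul_assoc, mul_smul_comm, smul_smul,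
    mul_neg, neg_neg, smul_neg, Complex.star_def, Complex.conj_I]
  simp only [mul_neg, neg_mul, Complex.I_mul_I, map_neg, Complex.conj_I, neg_neg, neg_smul,
    mul_one]
  have h4 : b i * star (a i) = (4 : ℂ) • (1 / 4 : ℂ) • (b i * star (a i)) := by
    rw [smul_smul]; norm_num
  module

end SquareSummable

section StandardModule

variable (A : Type*) [CStarAlgebra A] [PartialOrder A] [StarOrderedRing A]

/-- The standard Hilbert `A`-module `ℓ₂(A)`. It is a type of its own, so that it carries the
topology of its Hilbert module norm, not the product topology. -/
def StdModule : Type _ := squareSummable A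

instance : AddCommGroup (StdModule A) := inferInstanceAs (AddCommGroup (squareSummable A))
instance : Module A (StdModule A) := inferInstanceAs (Module A (squareSummable A))
instance : Module ℂ (StdModule A) := inferInstanceAs (Module ℂ (squareSummable A))

variable {A} in
/-- The `i`-th entry of an element of `ℓ₂(A)`. -/
def StdModule.coord (x : StdModule A) (i : ℕ) : A := x.1 i

variable {A} in
/-- The `A`-valued inner product `⟨x, y⟩ = ∑ x_i y_i⋆` of `ℓ₂(A)`, `A`-linear in `x`. -/
def StdModule.pairing (x y : StdModule A) : A := ∑' i, x.coord i * star (y.coord i)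

variable {A} in
/-- The series of the inner product converges in norm. -/
theorem StdModule.hasSum_pairing (x y : StdModule A) :
    HasSum (fun i => x.coord i * star (y.coord i)) (x.pairing y) :=
  (summable_mul_star y.2 x.2).hasSum

/-- The Hilbert module norm `‖x‖ = ‖⟨x, x⟩‖^(1/2)`. -/
instance : Norm (StdModule A) := ⟨fun x => √‖x.pairing x‖⟩

/-- `ℓ₂(A)` as a Hilbert module. In Mathlib's convention `inner A x y` is `A`-linear in its second
argument, so `inner A x y` stands for `⟨y, x⟩`. -/
instance : CStarModule A (StdModule A) where
  inner x y := y.pairing x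
  inner_add_right {x y z} := by
    refine (StdModule.hasSum_pairing (y + z) x).unique ?_
    refine ((StdModule.hasSum_pairing y x).add (StdModule.hasSum_pairing z x)).congr_fun ?_
    intro i
    exact add_mul _ _ _
  inner_self_nonneg {x} := tsum_nonneg fun i => mul_star_self_nonneg _
  inner_self {x} := by
    constructor
    · intro h
      have hx := StdModule.hasSum_pairing x x
      rw [h] at hx
      have h0 := (hasSum_zero_iff_of_nonneg fun i => mul_star_self_nonneg (x.coord i)).1 hx
      refine Subtype.ext (funext fun i => ?_)
      exact (CStarRing.mul_star_self_eq_zero_iff _).1 (congrFun h0 i)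
    · rintro rfl
      refine (StdModule.hasSum_pairing (0 : StdModule A) 0).unique ?_
      convert (hasSum_zero : HasSum (fun _ : ℕ => (0 : A)) 0) using 2 with i
      exact zero_mul _
  inner_op_smul_right {a x y} := by
    refine (StdModule.hasSum_pairing (a • y) x).unique ?_
    refine ((StdModule.hasSum_pairing y x).mul_left a).congr_fun ?_
    intro i
    exact mul_assoc _ _ _
  inner_smul_right_complex {z x y} := by
    refine (StdModule.hasSum_pairing (z • y) x).unique ?_
    refine ((StdModule.hasSum_pairing y x).const_smul z).congr_fun ?_
    intro i
    exact smul_mul_assoc _ _ _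
  star_inner x y := by
    refine (StdModule.hasSum_pairing y x).star.unique ?_
    refine (StdModule.hasSum_pairing x y).congr_fun ?_
    intro i
    exact (star_mul _ _).trans (by rw [star_star])
  norm_eq_sqrt_norm_inner_self x := rfl

instance : NormedAddCommGroup (StdModule A) := CStarModule.normedAddCommGroup A
instance : NormedSpace ℂ (StdModule A) := .ofCore (CStarModule.normedSpaceCore A)

end StandardModule

section Frames

variable (A : Type*) [CStarAlgebra A] [PartialOrder A] [StarOrderedRing A]
  {E : Type*} [NormedAddCommGroup E] [Module ℂ E] [Module A E] [CStarModule A E] {J : Type*}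

/-- `x` is a standard frame of the Hilbert `A`-module `E`: for some constants `C, D > 0` and
every `y`, the series `∑ ⟨y, x_j⟩⟨x_j, y⟩` converges in norm and
`C ⟨y, y⟩ ≤ ∑ ⟨y, x_j⟩⟨x_j, y⟩ ≤ D ⟨y, y⟩`. (Mathlib's `inner A x y` is `⟨y, x⟩`.) -/
def IsStandardFrame (x : J → E) : Prop :=
  ∃ C D : ℝ, 0 < C ∧ 0 < D ∧ ∀ y : E,
    Summable (fun j => inner A (x j) y * inner A y (x j)) ∧
    C • inner A y y ≤ ∑' j, inner A (x j) y * inner A y (x j) ∧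
    ∑' j, inner A (x j) y * inner A y (x j) ≤ D • inner A y y

/-- `D` is an upper frame bound of the standard frame `x` (not required to be the least one). -/
def IsUpperFrameBound (x : J → E) (D : ℝ) : Prop :=
  0 < D ∧ ∀ y : E, ∑' j, inner A (x j) y * inner A y (x j) ≤ D • inner A y y

open Classical in
/-- `f` is an orthonormal basis of the Hilbert `A`-module `E`: `⟨f_i, f_j⟩ = δ_ij 1_A`, and the
finite `A`-linear combinations of the `f_j` are norm-dense in `E`. -/
structure IsOrthonormalBasis (f : J → E) : Prop where
  inner_eq : ∀ i j, inner A (f i) (f j) = if i = j then (1 : A) else 0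
  dense_span : Dense (Submodule.span A (Set.range f) : Set E)

end Frames

end HilbertModuleFrames

end

/-! Let `e_k` be the standard basis of `ℓ₂(A)`, and index the frame by `ℕ`. The upper frame bound
says that the analysis operator `y ↦ (⟨y, x_k⟩)_k` has norm at most `√D`. By duality its adjoint,
the synthesis operator `T` with `T e_k = x_k`, exists and has norm at most `√D`.

Fix `c > √D` and put `s = T / c`, so `‖s‖ < 1`. Adjointable operators form a C⋆-algebra, and there
`(1 + s) / 2` is an invertible contraction, hence `u * p` with `u` unitary and `0 ≤ p ≤ 1`. Since
`p` is the mean of the unitaries `p ± i √(1 - p²)`, `1 + s = v + w` with `v`, `w` unitary. Thus `T =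
c (-1 + v + w)`; applying this to `e_k` gives the three bases, as unitaries preserve orthonormal
bases.

The lower frame bound serves only to make `J` infinite when `A ≠ 0`. Both claims are choices of `c`;
the second uses `√D ≤ D`. The carrying lemmas are `exists_unitary_add_unitary_eq_one_add` and
`exists_adjointable_apply_basisVec`. -/

noncomputable section

/-! ### Sums of two unitaries in a C⋆-algebra -/

section UnitarySums

variable {B : Type*} [CStarAlgebra B]

/-- The polar decomposition of an invertible element of a C⋆-algebra. -/
theorem IsUnit.exists_unitary_mul_cfcAbs [PartialOrder B] [StarOrderedRing B] {a : B}
    (ha : IsUnit a) : ∃ u ∈ unitary B, a = u * CFC.abs a := by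
  have hh : IsUnit (CFC.abs a) := by
    rw [← isUnit_pow_iff two_ne_zero, CFC.abs_sq]
    exact ha.star.mul ha
  set k := Ring.inverse (CFC.abs a) with hk
  have hk1 : k * CFC.abs a = 1 := Ring.inverse_mul_cancel _ hh
  have hk2 : CFC.abs a * k = 1 := Ring.mul_inverse_cancel _ hh
  have hks : star k = k := by
    rw [hk, ← Ring.inverse_star, (CFC.abs_nonneg a).isSelfAdjoint.star_eq]
  have hu : star (a * k) * (a * k) = 1 :=
    calc star (a * k) * (a * k) = k * (star a * a) * k := by rw [star_mul, hks]; noncomm_ring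
      _ = (k * CFC.abs a) * (CFC.abs a * k) := by rw [← CFC.abs_mul_abs]; noncomm_ring
      _ = 1 := by rw [hk1, hk2, one_mul]
  -- An invertible isometry is unitary: its left inverse `star (a * k)` is also its right inverse.
  have hunit : IsUnit (a * k) := ha.mul ⟨⟨k, CFC.abs a, hk1, hk2⟩, rfl⟩
  refine ⟨a * k, Unitary.mem_iff.2 ⟨hu, ?_⟩, by rw [mul_assoc, hk1, mul_one]⟩
  have : star (a * k) = Ring.inverse (a * k) := by
    rw [← mul_one (star (a * k)), ← Ring.mul_inverse_cancel _ hunit, ← mul_assoc, hu, one_mul]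
  rw [this, Ring.mul_inverse_cancel _ hunit]

/-- If `‖s‖ < 1`, then `1 + s` is a sum of two unitaries. -/
theorem exists_unitary_add_unitary_eq_one_add {s : B} (hs : ‖s‖ < 1) :
    ∃ v ∈ unitary B, ∃ w ∈ unitary B, 1 + s = v + w := by
  let _ := CStarAlgebra.spectralOrder B
  have _ := CStarAlgebra.spectralOrderedRing B
  set a : B := (2⁻¹ : ℝ) • (1 + s) with ha
  have hunit : IsUnit a := by
    have h1 : IsUnit (1 - -s) := isUnit_one_sub_of_norm_lt_one (by simpa using hs)
    rw [sub_neg_eq_add] at h1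
    exact h1.smul (Units.mk0 (2⁻¹ : ℝ) (by norm_num))
  have hnorm : ‖CFC.abs a‖ ≤ 1 := by
    rcases subsingleton_or_nontrivial B with hB | hB
    · simp [Subsingleton.elim (CFC.abs a) 0]
    rw [CFC.norm_abs, ha, norm_smul]
    have : ‖1 + s‖ ≤ 2 := (norm_add_le _ _).trans (by rw [norm_one]; linarith)
    norm_num
    linarith
  obtain ⟨u, hu, hua⟩ := hunit.exists_unitary_mul_cfcAbs
  have hsa : IsSelfAdjoint (CFC.abs a) := (CFC.abs_nonneg a).isSelfAdjoint
  -- The function `t + i √(1 - t²)` maps `[0, 1]` into the unit circle and has real part `t`.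
  set w : B := CFC.abs a + Complex.I • CFC.sqrt (1 - CFC.abs a ^ 2) with hw
  have hwu : w ∈ unitary B := hsa.self_add_I_smul_cfcSqrt_sub_sq_mem_unitary _ hnorm
  have hws : w + star w = (2 : ℝ) • CFC.abs a := by
    have hq : star (CFC.sqrt (1 - CFC.abs a ^ 2)) = CFC.sqrt (1 - CFC.abs a ^ 2) :=
      (CFC.sqrt_nonneg (1 - CFC.abs a ^ 2)).isSelfAdjoint.star_eq
    rw [hw, star_add, star_smul, hsa.star_eq, hq, two_smul, Complex.star_def, Complex.conj_I,
      neg_smul]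
    abel
  refine ⟨u * w, mul_mem hu hwu, u * star w, mul_mem hu (Unitary.star_mem hwu), ?_⟩
  rw [← mul_add, hws, mul_smul_comm, ← hua, ha, smul_smul]
  norm_num

end UnitarySums

namespace HilbertModuleFrames

/-! ### The C⋆-algebra of adjointable operators -/

section Adjointable

variable (A : Type*) [CStarAlgebra A] [PartialOrder A]
  {E : Type*} [NormedAddCommGroup E] [NormedSpace ℂ E] [Module A E] [CStarModule A E]

/-- `S` is an adjoint of `T` for the `A`-valued inner product. -/
def IsAdjointPair (T S : E →L[ℂ] E) : Prop :=
  ∀ x y : E, inner A (T x) y = inner A x (S y)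

variable {A}

theorem ext_inner_left {x y : E} (h : ∀ z : E, inner A z x = inner A z y) : x = y := by
  rw [← sub_eq_zero, ← CStarModule.inner_self (A := A), CStarModule.inner_sub_right, h, sub_self]

namespace IsAdjointPair

variable {T S T' S' : E →L[ℂ] E}

theorem symm (h : IsAdjointPair A T S) : IsAdjointPair A S T := fun x y => by
  rw [← CStarModule.star_inner, ← h, CStarModule.star_inner]

theorem unique (h : IsAdjointPair A T S) (h' : IsAdjointPair A T S') : S = S' :=
  ContinuousLinearMap.ext fun x => ext_inner_left (A := A) fun z => by rw [← h, h']

theorem one : IsAdjointPair A (1 : E →L[ℂ] E) 1 := fun x y => by simp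

theorem add (h : IsAdjointPair A T S) (h' : IsAdjointPair A T' S') :
    IsAdjointPair A (T + T') (S + S') := fun x y => by simp [h x y, h' x y]

theorem sub (h : IsAdjointPair A T S) (h' : IsAdjointPair A T' S') :
    IsAdjointPair A (T - T') (S - S') := fun x y => by simp [h x y, h' x y]

theorem mul (h : IsAdjointPair A T S) (h' : IsAdjointPair A T' S') :
    IsAdjointPair A (T * T') (S' * S) := fun x y => by
  change inner A (T (T' x)) y = inner A x (S' (S y))
  rw [h, h']

theorem smul (h : IsAdjointPair A T S) (z : ℂ) : IsAdjointPair A (z • T) (star z • S) :=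
  fun x y => by simp [h x y]

theorem algebraMap (z : ℂ) :
    IsAdjointPair A (algebraMap ℂ (E →L[ℂ] E) z) (algebraMap ℂ (E →L[ℂ] E) (star z)) := by
  rw [Algebra.algebraMap_eq_smul_one, Algebra.algebraMap_eq_smul_one]
  exact one.smul z

/-- Adjointable operators are `A`-linear. -/
theorem map_smul (h : IsAdjointPair A T S) (a : A) (x : E) : T (a • x) = a • T x :=
  ext_inner_left (A := A) fun z => by
    rw [← h.symm, CStarModule.inner_op_smul_right, CStarModule.inner_op_smul_right, h.symm]

variable [StarOrderedRing A]

/-- Cauchy–Schwarz applied to `⟨T x, T x⟩ = ⟨x, S T x⟩`; this is the source of the C⋆-inequality. -/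
theorem norm_apply_sq_le (h : IsAdjointPair A T S) (x : E) :
    ‖T x‖ ^ 2 ≤ ‖S * T‖ * ‖x‖ ^ 2 := by
  rw [CStarModule.norm_sq_eq A, h]
  calc ‖(inner A x (S (T x)) : A)‖ ≤ ‖x‖ * ‖(S * T) x‖ := CStarModule.norm_inner_le E
    _ ≤ ‖x‖ * (‖S * T‖ * ‖x‖) := by gcongr; exact (S * T).le_opNorm x
    _ = ‖S * T‖ * ‖x‖ ^ 2 := by ring

theorem norm_mul_self_le (h : IsAdjointPair A T S) : ‖T‖ * ‖T‖ ≤ ‖S * T‖ := by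
  have h1 : ‖T‖ ≤ √‖S * T‖ := by
    refine ContinuousLinearMap.opNorm_le_bound _ (Real.sqrt_nonneg _) fun x => ?_
    rw [← abs_of_nonneg (norm_nonneg (T x))]
    refine Real.abs_le_sqrt (h.norm_apply_sq_le x) |>.trans_eq ?_
    rw [Real.sqrt_mul (norm_nonneg _), Real.sqrt_sq (norm_nonneg _)]
  calc ‖T‖ * ‖T‖ ≤ √‖S * T‖ * √‖S * T‖ := by gcongr
    _ = ‖S * T‖ := Real.mul_self_sqrt (norm_nonneg _)

theorem norm_le (h : IsAdjointPair A T S) : ‖T‖ ≤ ‖S‖ := by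
  have h1 := h.norm_mul_self_le.trans (norm_mul_le S T)
  rcases (norm_nonneg T).eq_or_lt with h0 | h0
  · rw [← h0]; exact norm_nonneg _
  · exact le_of_mul_le_mul_right h1 h0

theorem norm_eq (h : IsAdjointPair A T S) : ‖T‖ = ‖S‖ := le_antisymm h.norm_le h.symm.norm_le

end IsAdjointPair

variable (A E)

/-- The algebra of adjointable operators of a Hilbert module. -/
def Adjointable : Subalgebra ℂ (E →L[ℂ] E) where
  carrier := {T | ∃ S, IsAdjointPair A T S}
  mul_mem' := fun ⟨_, h⟩ ⟨_, h'⟩ => ⟨_, h.mul h'⟩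
  add_mem' := fun ⟨_, h⟩ ⟨_, h'⟩ => ⟨_, h.add h'⟩
  algebraMap_mem' z := ⟨_, .algebraMap z⟩

variable {A E}

namespace Adjointable

/-- The adjoint of an adjointable operator. -/
def adjoint (T : Adjointable A E) : E →L[ℂ] E := T.2.choose

theorem isAdjointPair (T : Adjointable A E) : IsAdjointPair A T.1 (adjoint T) :=
  T.2.choose_spec

instance : Star (Adjointable A E) := ⟨fun T => ⟨adjoint T, T.1, (isAdjointPair T).symm⟩⟩

theorem isAdjointPair_star (T : Adjointable A E) :
    IsAdjointPair A T.1 (star T).1 := isAdjointPair T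

theorem star_eq_of_isAdjointPair {T S : Adjointable A E}
    (h : IsAdjointPair A T.1 S.1) : star T = S :=
  Subtype.ext ((isAdjointPair_star T).unique h)

instance : StarRing (Adjointable A E) where
  star_involutive T := star_eq_of_isAdjointPair (isAdjointPair_star T).symm
  star_mul T S := star_eq_of_isAdjointPair
    ((isAdjointPair_star T).mul (isAdjointPair_star S))
  star_add T S := star_eq_of_isAdjointPair
    ((isAdjointPair_star T).add (isAdjointPair_star S))

instance : StarModule ℂ (Adjointable A E) where
  star_smul z T := star_eq_of_isAdjointPair ((isAdjointPair_star T).smul z)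

theorem inner_unitary_apply {u : Adjointable A E} (hu : u ∈ unitary (Adjointable A E)) (x y : E) :
    inner A (u.1 x) (u.1 y) = (inner A x y : A) := by
  have h : (star u).1 (u.1 y) = y :=
    DFunLike.congr_fun (congrArg Subtype.val (Unitary.star_mul_self_of_mem hu)) y
  rw [isAdjointPair_star u, h]

/-- Unitaries map orthonormal bases to orthonormal bases. -/
theorem isOrthonormalBasis_map_unitary {J : Type*} {f : J → E} (hf : IsOrthonormalBasis A f)
    {u : Adjointable A E} (hu : u ∈ unitary (Adjointable A E)) :
    IsOrthonormalBasis A fun j => u.1 (f j) where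
  inner_eq i j := by rw [inner_unitary_apply hu, hf.inner_eq]
  dense_span := by
    -- `u` is bundled only as a `ℂ`-linear map; its `A`-linearity is what makes the image of an
    -- `A`-span an `A`-span.
    let L : E →ₗ[A] E :=
      { toFun := u.1
        map_add' := map_add u.1
        map_smul' := (isAdjointPair_star u).map_smul }
    have hsurj : Function.Surjective u.1 := fun y =>
      ⟨(star u).1 y, DFunLike.congr_fun (congrArg Subtype.val (Unitary.mul_star_self_of_mem hu)) y⟩
    have h := hsurj.denseRange.dense_image u.1.continuous hf.dense_span
    have h2 : (Submodule.span A (Set.range fun j => u.1 (f j)) : Set E)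
        = u.1 '' (Submodule.span A (Set.range f)) := by
      have : (Set.range fun j => u.1 (f j)) = L '' Set.range f := (Set.range_comp L f)
      rw [this, Submodule.span_image]
      rfl
    rwa [h2]

variable [StarOrderedRing A]

instance : CStarRing (Adjointable A E) where
  norm_mul_self_le T := (isAdjointPair_star T).norm_mul_self_le

/-- Taking adjoints is isometric, so the adjoints of a Cauchy sequence are Cauchy too; continuity of
the inner product makes the two limits an adjoint pair. -/
instance [CompleteSpace E] : CompleteSpace (Adjointable A E) := by
  refine Metric.complete_of_cauchySeq_tendsto fun u hu => ?_
  have hv : CauchySeq fun n => (star (u n)).1 := by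
    rw [Metric.cauchySeq_iff] at hu ⊢
    intro ε hε
    obtain ⟨N, hN⟩ := hu ε hε
    refine ⟨N, fun m hm n hn => ?_⟩
    have h := hN m hm n hn
    rw [dist_eq_norm] at h ⊢
    rwa [← ((isAdjointPair_star (u m)).sub (isAdjointPair_star (u n))).norm_eq]
  have hu' : CauchySeq fun n => (u n).1 := hu.map (isometry_subtype_coe.uniformContinuous)
  obtain ⟨T, hT⟩ := cauchySeq_tendsto_of_complete hu'
  obtain ⟨S, hS⟩ := cauchySeq_tendsto_of_complete hv
  have hTS : IsAdjointPair A T S := fun x y => by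
    have h1 : Filter.Tendsto (fun n => (u n).1 x) Filter.atTop (nhds (T x)) :=
      ((ContinuousLinearMap.apply ℂ E x).continuous.tendsto T).comp hT
    have h2 : Filter.Tendsto (fun n => (star (u n)).1 y) Filter.atTop (nhds (S y)) :=
      ((ContinuousLinearMap.apply ℂ E y).continuous.tendsto S).comp hS
    have h3 : Filter.Tendsto (fun n => (inner A ((u n).1 x) y : A)) Filter.atTop
        (nhds (inner A (T x) y)) :=
      (CStarModule.continuous_inner (A := A) (E := E)).tendsto (T x, y) |>.comp
        (h1.prodMk_nhds tendsto_const_nhds)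
    have h4 : Filter.Tendsto (fun n => (inner A x ((star (u n)).1 y) : A)) Filter.atTop
        (nhds (inner A x (S y))) :=
      (CStarModule.continuous_inner (A := A) (E := E)).tendsto (x, S y) |>.comp
        (tendsto_const_nhds.prodMk_nhds h2)
    refine tendsto_nhds_unique h3 (h4.congr fun n => ?_)
    exact (isAdjointPair_star (u n) x y).symm
  exact ⟨⟨T, S, hTS⟩, tendsto_subtype_rng.2 hT⟩

instance [CompleteSpace E] : CStarAlgebra (Adjointable A E) where

end Adjointable

end Adjointable

open Filter Topology

/-! ### Completeness and the standard basis of `ℓ₂(A)` -/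

section StandardBasis

variable {A : Type*} [CStarAlgebra A] [PartialOrder A] [StarOrderedRing A]

namespace StdModule

theorem ext {x y : StdModule A} (h : ∀ i, x.coord i = y.coord i) : x = y :=
  Subtype.ext (funext h)

theorem coord_add (x y : StdModule A) (i : ℕ) : (x + y).coord i = x.coord i + y.coord i := rfl

theorem coord_sub (x y : StdModule A) (i : ℕ) : (x - y).coord i = x.coord i - y.coord i := rfl

theorem hasSum_inner (x y : StdModule A) :
    HasSum (fun i => y.coord i * star (x.coord i)) (inner A x y) :=
  hasSum_pairing y x

theorem norm_sum_coord_le (x : StdModule A) (s : Finset ℕ) :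
    ‖∑ i ∈ s, x.coord i * star (x.coord i)‖ ≤ ‖x‖ ^ 2 := by
  rw [CStarModule.norm_sq_eq A]
  refine CStarAlgebra.norm_le_norm_of_nonneg_of_le
    (Finset.sum_nonneg fun i _ => mul_star_self_nonneg _) ?_
  exact sum_le_hasSum s (fun i _ => mul_star_self_nonneg _) (hasSum_inner x x)

theorem norm_coord_le (x : StdModule A) (i : ℕ) : ‖x.coord i‖ ≤ ‖x‖ := by
  have h := norm_sum_coord_le x {i}
  rw [Finset.sum_singleton, CStarRing.norm_self_mul_star, ← sq] at h
  exact le_of_sq_le_sq h (norm_nonneg x)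

theorem add_mul_star_add_le (a b : A) :
    (a + b) * star (a + b) ≤ (2 : ℝ) • (a * star a + b * star b) := by
  have h0 : 0 ≤ (a - b) * star (a - b) := mul_star_self_nonneg _
  have h1 : (2 : ℝ) • (a * star a + b * star b)
      = (a + b) * star (a + b) + (a - b) * star (a - b) := by
    simp only [star_add, star_sub, two_smul]
    noncomm_ring
  rw [h1]
  exact le_add_of_nonneg_right h0

instance : CompleteSpace (StdModule A) := by
  refine Metric.complete_of_cauchySeq_tendsto fun u hu => ?_
  have hc : ∀ i, ∃ a, Tendsto (fun n => (u n).coord i) atTop (𝓝 a) := fun i => by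
    refine cauchySeq_tendsto_of_complete ?_
    rw [Metric.cauchySeq_iff] at hu ⊢
    intro ε hε
    obtain ⟨N, hN⟩ := hu ε hε
    refine ⟨N, fun m hm n hn => lt_of_le_of_lt ?_ (hN m hm n hn)⟩
    rw [dist_eq_norm, dist_eq_norm, ← coord_sub]
    exact norm_coord_le _ i
  choose a ha using hc
  -- The Cauchy estimate on a finite set of coordinates survives the coordinatewise limit `m → ∞`,
  -- uniformly in the finite set.
  have key : ∀ ε > 0, ∃ N, ∀ n ≥ N, ∀ s : Finset ℕ,
      ‖∑ i ∈ s, (a i - (u n).coord i) * star (a i - (u n).coord i)‖ ≤ ε ^ 2 := by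
    intro ε hε
    obtain ⟨N, hN⟩ := Metric.cauchySeq_iff.1 hu ε hε
    refine ⟨N, fun n hn s => ?_⟩
    have hlim : Tendsto (fun m => ‖∑ i ∈ s, (u m - u n).coord i * star ((u m - u n).coord i)‖)
        atTop (𝓝 ‖∑ i ∈ s, (a i - (u n).coord i) * star (a i - (u n).coord i)‖) := by
      refine (tendsto_finsetSum s fun i _ => ?_).norm
      have h1 := (ha i).sub_const ((u n).coord i)
      exact h1.mul h1.star
    refine le_of_tendsto hlim (eventually_atTop.2 ⟨N, fun m hm => ?_⟩)
    refine (norm_sum_coord_le _ s).trans ?_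
    have := hN m hm n hn
    rw [dist_eq_norm] at this
    gcongr
  have hmem : a ∈ squareSummable A := by
    change Summable fun i => a i * star (a i)
    rw [summable_iff_vanishing_norm]
    intro ε hε
    -- The tail is then at most `2 (δ² + ε / 8) = ε / 2`.
    set δ := √(ε / 8) with hδ
    have hδ0 : 0 < δ := by positivity
    have hδ2 : δ ^ 2 = ε / 8 := Real.sq_sqrt (by positivity)
    obtain ⟨N, hN⟩ := key δ hδ0
    obtain ⟨s, hs⟩ := summable_iff_vanishing_norm.1 (hasSum_inner (u N) (u N)).summable
      (ε / 8) (by positivity)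
    refine ⟨s, fun t ht => ?_⟩
    have h1 := hN N le_rfl t
    have h2 := hs t ht
    have hle : ∑ i ∈ t, a i * star (a i) ≤ (2 : ℝ) •
        (∑ i ∈ t, (a i - (u N).coord i) * star (a i - (u N).coord i)
          + ∑ i ∈ t, (u N).coord i * star ((u N).coord i)) := by
      rw [← Finset.sum_add_distrib, Finset.smul_sum]
      refine Finset.sum_le_sum fun i _ => ?_
      simpa using add_mul_star_add_le (a i - (u N).coord i) ((u N).coord i)
    have h3 := CStarAlgebra.norm_le_norm_of_nonneg_of_le
      (Finset.sum_nonneg fun i _ => mul_star_self_nonneg _) hle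
    rw [norm_smul, Real.norm_two] at h3
    have h4 := norm_add_le (∑ i ∈ t, (a i - (u N).coord i) * star (a i - (u N).coord i))
      (∑ i ∈ t, (u N).coord i * star ((u N).coord i))
    linarith
  let b : StdModule A := ⟨a, hmem⟩
  refine ⟨b, Metric.tendsto_atTop.2 fun ε hε => ?_⟩
  obtain ⟨N, hN⟩ := key (ε / 2) (by positivity)
  refine ⟨N, fun n hn => ?_⟩
  have h : ‖b - u n‖ ^ 2 ≤ (ε / 2) ^ 2 := by
    rw [CStarModule.norm_sq_eq A]
    exact le_of_tendsto (hasSum_inner (b - u n) (b - u n)).norm (Eventually.of_forall (hN n hn))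
  have := le_of_sq_le_sq h (by positivity)
  rw [dist_comm, dist_eq_norm]
  linarith

variable (A) in
/-- The standard basis of `ℓ₂(A)`. -/
def basisVec (k : ℕ) : StdModule A :=
  ⟨Pi.single k 1, by
    change Summable fun i => (Pi.single k 1 : ℕ → A) i * star ((Pi.single k 1 : ℕ → A) i)
    refine summable_of_ne_finset_zero (s := {k}) fun i hi => ?_
    rw [Pi.single_eq_of_ne (by simpa using hi), zero_mul]⟩

theorem coord_basisVec (k i : ℕ) : (basisVec A k).coord i = if i = k then 1 else 0 :=
  Pi.single_apply k (1 : A) i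

theorem inner_basisVec_left (k : ℕ) (x : StdModule A) :
    inner A (basisVec A k) x = x.coord k := by
  refine (hasSum_inner _ x).unique ?_
  convert hasSum_ite_eq k (x.coord k) using 2 with i
  rw [coord_basisVec]
  split_ifs with h
  · simp [h]
  · simp

theorem inner_basisVec_right (k : ℕ) (x : StdModule A) :
    inner A x (basisVec A k) = star (x.coord k) := by
  rw [← CStarModule.star_inner, inner_basisVec_left]

theorem coord_sum_smul_basisVec (c : ℕ → A) (s : Finset ℕ) (i : ℕ) :
    (∑ j ∈ s, c j • basisVec A j).coord i = if i ∈ s then c i else 0 := by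
  rw [← inner_basisVec_left, CStarModule.inner_sum_right]
  simp_rw [CStarModule.inner_op_smul_right, inner_basisVec_left, coord_basisVec]
  simp

theorem norm_sum_smul_basisVec_sq (c : ℕ → A) (s : Finset ℕ) :
    ‖∑ j ∈ s, c j • basisVec A j‖ ^ 2 = ‖∑ j ∈ s, c j * star (c j)‖ := by
  rw [CStarModule.norm_sq_eq A]
  congr 1
  rw [CStarModule.inner_sum_right]
  refine Finset.sum_congr rfl fun j hj => ?_
  rw [CStarModule.inner_op_smul_right, inner_basisVec_right, coord_sum_smul_basisVec, if_pos hj]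

theorem hasSum_coord_smul_basisVec (x : StdModule A) :
    HasSum (fun j => x.coord j • basisVec A j) x := by
  have hsum : Summable fun j => x.coord j • basisVec A j := by
    rw [summable_iff_vanishing_norm]
    intro ε hε
    obtain ⟨s, hs⟩ := summable_iff_vanishing_norm.1 (hasSum_inner x x).summable
      (ε ^ 2) (by positivity)
    refine ⟨s, fun t ht => ?_⟩
    have h := hs t ht
    rw [← norm_sum_smul_basisVec_sq] at h
    exact lt_of_pow_lt_pow_left₀ 2 hε.le h
  convert hsum.hasSum using 1
  refine ext fun i => ?_
  have h : HasSum (fun j => (inner A (basisVec A i) (x.coord j • basisVec A j) : A))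
      (inner A (basisVec A i) (∑' j, x.coord j • basisVec A j)) :=
    hsum.hasSum.mapL (CStarModule.innerSL (A := A) (basisVec A i))
  have h2 : (fun j => (inner A (basisVec A i) (x.coord j • basisVec A j) : A))
      = fun j => if j = i then x.coord i else 0 := by
    funext j
    rw [CStarModule.inner_op_smul_right, inner_basisVec_left, coord_basisVec]
    by_cases hij : i = j
    · simp [hij]
    · simp [hij, Ne.symm hij]
  rw [h2] at h
  rw [← inner_basisVec_left i (∑' _, _)]
  exact (hasSum_ite_eq i (x.coord i)).unique h

theorem isOrthonormalBasis_basisVec {J : Type*} (σ : J ≃ ℕ) :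
    IsOrthonormalBasis A fun j => basisVec A (σ j) where
  inner_eq i j := by
    rw [inner_basisVec_left, coord_basisVec]
    by_cases h : i = j
    · rw [if_pos h, if_pos (congrArg σ h)]
    · rw [if_neg h, if_neg (σ.injective.ne h)]
  dense_span x := by
    refine mem_closure_of_tendsto (hasSum_coord_smul_basisVec x) (Eventually.of_forall fun s => ?_)
    refine Submodule.sum_mem _ fun j _ => Submodule.smul_mem _ _ (Submodule.subset_span ?_)
    exact ⟨σ.symm j, by simp⟩

end StdModule

end StandardBasis

/-! ### The synthesis operator and the three bases -/

section Synthesis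

variable {A : Type*} [CStarAlgebra A] [PartialOrder A] [StarOrderedRing A]

open StdModule

/-- A Bessel sequence of `ℓ₂(A)` with bound `D` is the image of the standard basis under an
adjointable operator of norm at most `√D`. -/
theorem exists_adjointable_apply_basisVec (x : ℕ → StdModule A) {D : ℝ} (hD : 0 < D)
    (hs : ∀ y, Summable fun k => inner A (x k) y * inner A y (x k))
    (hb : ∀ y, ∑' k, inner A (x k) y * inner A y (x k) ≤ D • inner A y y) :
    ∃ T : Adjointable A (StdModule A), ‖T‖ ≤ √D ∧ ∀ k, T.1 (basisVec A k) = x k := by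
  let U : StdModule A → StdModule A := fun y => ⟨fun k => inner A (x k) y, by
    change Summable fun k => inner A (x k) y * star (inner A (x k) y)
    simpa only [CStarModule.star_inner] using hs y⟩
  have hUc : ∀ y k, (U y).coord k = inner A (x k) y := fun _ _ => rfl
  have hUn : ∀ y, ‖U y‖ ≤ √D * ‖y‖ := fun y => by
    have h1 : (inner A (U y) (U y) : A) = ∑' k, inner A (x k) y * inner A y (x k) := by
      rw [← (hasSum_inner (U y) (U y)).tsum_eq]
      simp only [hUc, CStarModule.star_inner]
    have h2 : ‖U y‖ ^ 2 ≤ (√D * ‖y‖) ^ 2 := by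
      rw [mul_pow, Real.sq_sqrt hD.le, CStarModule.norm_sq_eq A, CStarModule.norm_sq_eq A]
      refine (CStarAlgebra.norm_le_norm_of_nonneg_of_le CStarModule.inner_self_nonneg
        (h1.trans_le (hb y))).trans_eq ?_
      rw [norm_smul, Real.norm_of_nonneg hD.le]
    exact le_of_sq_le_sq h2 (by positivity)
  -- Duality: a vector `z` synthesized from `c` satisfies `⟨z, z⟩ = ⟨c, U z⟩`, so `‖z‖² ≤ √D ‖z‖
  -- ‖c‖`. It serves first for finite sums, giving convergence, then for `V` itself.
  have le_of_inner : ∀ c z : StdModule A, (inner A z z : A) = inner A (U z) c →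
      ‖z‖ ≤ √D * ‖c‖ := fun c z h => by
    have h1 : ‖z‖ * ‖z‖ ≤ (√D * ‖c‖) * ‖z‖ := by
      rw [← sq, CStarModule.norm_sq_eq A, h]
      refine (CStarModule.norm_inner_le _).trans ?_
      calc ‖U z‖ * ‖c‖ ≤ (√D * ‖z‖) * ‖c‖ := by gcongr; exact hUn z
        _ = _ := by ring
    rcases (norm_nonneg z).eq_or_lt with h0 | h0
    · rw [← h0]; positivity
    · exact le_of_mul_le_mul_right h1 h0
  have hsum : ∀ c : StdModule A, Summable fun k => c.coord k • x k := fun c => by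
    have hfin : ∀ t : Finset ℕ, ‖∑ k ∈ t, c.coord k • x k‖
        ≤ √D * ‖∑ k ∈ t, c.coord k • basisVec A k‖ := fun t => by
      have h : ∀ z : StdModule A, (inner A z (∑ k ∈ t, c.coord k • x k) : A)
          = inner A (U z) (∑ k ∈ t, c.coord k • basisVec A k) := fun z => by
        simp only [CStarModule.inner_sum_right, CStarModule.inner_op_smul_right,
          inner_basisVec_right, hUc, CStarModule.star_inner]
      exact le_of_inner _ _ (h _)
    rw [summable_iff_vanishing_norm]
    intro ε hε
    obtain ⟨s, hs⟩ := summable_iff_vanishing_norm.1 (hasSum_coord_smul_basisVec c).summable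
      (ε / √D) (by positivity)
    refine ⟨s, fun t ht => (hfin t).trans_lt ?_⟩
    have h0 : 0 < √D := Real.sqrt_pos.2 hD
    have h := (lt_div_iff₀ h0).1 (hs t ht)
    rwa [mul_comm] at h
  let V : StdModule A → StdModule A := fun c => ∑' k, c.coord k • x k
  have hV : ∀ y c, (inner A y (V c) : A) = inner A (U y) c := fun y c => by
    have h : HasSum (fun k => (inner A y (c.coord k • x k) : A)) (inner A y (V c)) :=
      (hsum c).hasSum.mapL (CStarModule.innerSL (A := A) y)
    refine h.unique ?_
    have h2 := hasSum_inner (U y) c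
    simpa only [hUc, CStarModule.star_inner, CStarModule.inner_op_smul_right] using h2
  let UL : StdModule A →L[ℂ] StdModule A := LinearMap.mkContinuous
    { toFun := U
      map_add' := fun y z => StdModule.ext fun k => by
        rw [coord_add, hUc, hUc, hUc, CStarModule.inner_add_right]
      map_smul' := fun a y => StdModule.ext fun k =>
        CStarModule.inner_smul_right_complex } (√D) hUn
  let VL : StdModule A →L[ℂ] StdModule A := LinearMap.mkContinuous
    { toFun := V
      map_add' := fun c d => ext_inner_left (A := A) fun y => by
        rw [CStarModule.inner_add_right, hV, hV, hV, CStarModule.inner_add_right]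
      map_smul' := fun a c => ext_inner_left (A := A) fun y => by
        rw [RingHom.id_apply, CStarModule.inner_smul_right_complex, hV, hV,
          CStarModule.inner_smul_right_complex] } (√D)
    fun c => le_of_inner _ _ (hV _ _)
  have hpair : IsAdjointPair A UL VL := fun y c => (hV y c).symm
  have hVL : ‖VL‖ ≤ √D := LinearMap.mkContinuous_norm_le _ (Real.sqrt_nonneg D) _
  refine ⟨⟨VL, UL, hpair.symm⟩, hVL, fun k => ext_inner_left (A := A) fun y => ?_⟩
  change inner A y (V (basisVec A k)) = inner A y (x k)
  rw [hV, inner_basisVec_right, hUc, CStarModule.star_inner]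

/-- A standard frame of `ℓ₂(A)`, for `A ≠ 0`, has infinitely many elements. -/
theorem IsStandardFrame.infinite [Nontrivial A] {J : Type*} {x : J → StdModule A}
    (hx : IsStandardFrame A x) : Infinite J := by
  by_contra hJ
  rw [not_infinite_iff_finite] at hJ
  have _ := Fintype.ofFinite J
  obtain ⟨C, D, hC, -, h⟩ := hx
  -- Testing the lower bound on the `k`-th basis vector bounds the `k`-th coordinates of the frame
  -- from below, yet in a finite family these tend to `0`.
  have hle : ∀ k, C ≤ ∑ j, ‖(x j).coord k * star ((x j).coord k)‖ := fun k => by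
    have h1 := (h (basisVec A k)).2.1
    rw [tsum_fintype] at h1
    simp only [inner_basisVec_left, inner_basisVec_right, coord_basisVec, if_true,
      star_one] at h1
    have h2 := CStarAlgebra.norm_le_norm_of_nonneg_of_le (smul_nonneg hC.le zero_le_one) h1
    rw [norm_smul, norm_one, mul_one, Real.norm_of_nonneg hC.le] at h2
    refine h2.trans ((norm_sum_le _ _).trans_eq (Finset.sum_congr rfl fun j _ => ?_))
    rw [CStarRing.norm_star_mul_self, CStarRing.norm_self_mul_star]
  have hlim : Tendsto (fun k => ∑ j, ‖(x j).coord k * star ((x j).coord k)‖) atTop (𝓝 0) := by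
    rw [show (0 : ℝ) = ∑ j : J, ‖(0 : A)‖ by simp]
    exact tendsto_finsetSum _ fun j _ =>
      (hasSum_inner (x j) (x j)).summable.tendsto_atTop_zero.norm
  exact absurd (ge_of_tendsto' hlim hle) (not_le.2 hC)

/-- A Bessel family of `ℓ₂(A)` with bound `D` is a multiple of a sum of three orthonormal bases,
with any factor larger than `√D`. -/
theorem exists_isOrthonormalBasis_add_add {J : Type*} (σ : J ≃ ℕ) (x : J → StdModule A) {D : ℝ}
    (hD : 0 < D) (hs : ∀ y, Summable fun j => inner A (x j) y * inner A y (x j))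
    (hb : ∀ y, ∑' j, inner A (x j) y * inner A y (x j) ≤ D • inner A y y) {c : ℝ} (hc : √D < c) :
    ∃ f g h : J → StdModule A, IsOrthonormalBasis A f ∧ IsOrthonormalBasis A g ∧
      IsOrthonormalBasis A h ∧ ∀ j, x j = c • (f j + g j + h j) := by
  obtain ⟨T, hT, hTx⟩ := exists_adjointable_apply_basisVec (fun k => x (σ.symm k)) hD
    (fun y => (σ.symm.summable_iff (f := fun j => inner A (x j) y * inner A y (x j))).2 (hs y))
    (fun y => by
      rw [σ.symm.tsum_eq fun j => inner A (x j) y * inner A y (x j)]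
      exact hb y)
  have hc0 : 0 < c := (Real.sqrt_nonneg D).trans_lt hc
  have hS : ‖c⁻¹ • T‖ < 1 := by
    rw [norm_smul, norm_inv, Real.norm_of_nonneg hc0.le, inv_mul_lt_one₀ hc0]
    exact hT.trans_lt hc
  obtain ⟨v, hv, w, hw, hvw⟩ := exists_unitary_add_unitary_eq_one_add hS
  have hbasis := isOrthonormalBasis_basisVec (A := A) σ
  have hneg : (-1 : Adjointable A (StdModule A)) ∈ unitary (Adjointable A (StdModule A)) := by
    simp [Unitary.mem_iff]
  -- The basis coming from `-1` cancels the `1` in `1 + s = v + w`.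
  refine ⟨_, _, _, Adjointable.isOrthonormalBasis_map_unitary hbasis hneg,
    Adjointable.isOrthonormalBasis_map_unitary hbasis hv,
    Adjointable.isOrthonormalBasis_map_unitary hbasis hw, fun j => ?_⟩
  have hsum : T = c • (-1 + v + w) := by
    rw [add_assoc, ← hvw, neg_add_cancel_left, smul_smul, mul_inv_cancel₀ hc0.ne', one_smul]
  have h := hTx (σ j)
  rw [σ.symm_apply_apply] at h
  rw [← h]
  exact DFunLike.congr_fun (congrArg Subtype.val hsum) _

theorem isOrthonormalBasis_of_subsingleton [Subsingleton A] {J : Type*} (f : J → StdModule A) :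
    IsOrthonormalBasis A f where
  inner_eq _ _ := Subsingleton.elim _ _
  dense_span x := by
    have : x = 0 := StdModule.ext fun _ => Subsingleton.elim _ _
    rw [this]
    exact subset_closure (zero_mem _)

end Synthesis

end HilbertModuleFrames

end

theorem mainTheorem8 {A : Type*} [CStarAlgebra A] [PartialOrder A] [StarOrderedRing A]
    {J : Type*} [Countable J] (x : J → HilbertModuleFrames.StdModule A)
    (hx : HilbertModuleFrames.IsStandardFrame A x)
    (D : ℝ) (hD : HilbertModuleFrames.IsUpperFrameBound A x D) (ε : ℝ) (hε : 0 < ε) :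
    (∃ f g h : J → HilbertModuleFrames.StdModule A,
      HilbertModuleFrames.IsOrthonormalBasis A f ∧
      HilbertModuleFrames.IsOrthonormalBasis A g ∧
      HilbertModuleFrames.IsOrthonormalBasis A h ∧
      ∀ j, x j = (√D * (1 + ε)) • (f j + g j + h j)) ∧
    (1 ≤ D → ∃ f g h : J → HilbertModuleFrames.StdModule A,
      HilbertModuleFrames.IsOrthonormalBasis A f ∧
      HilbertModuleFrames.IsOrthonormalBasis A g ∧
      HilbertModuleFrames.IsOrthonormalBasis A h ∧
      ∀ j, x j = (D * (1 + ε)) • (f j + g j + h j)) := by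
  have key : ∀ c : ℝ, √D < c → ∃ f g h : J → HilbertModuleFrames.StdModule A,
      HilbertModuleFrames.IsOrthonormalBasis A f ∧
      HilbertModuleFrames.IsOrthonormalBasis A g ∧
      HilbertModuleFrames.IsOrthonormalBasis A h ∧
      ∀ j, x j = c • (f j + g j + h j) := by
    intro c hc
    rcases subsingleton_or_nontrivial A with hA | hA
    -- Over the zero algebra `J` may be finite, but every family is an orthonormal basis.
    · exact ⟨x, x, x, HilbertModuleFrames.isOrthonormalBasis_of_subsingleton x,
        HilbertModuleFrames.isOrthonormalBasis_of_subsingleton x,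
        HilbertModuleFrames.isOrthonormalBasis_of_subsingleton x,
        fun j => HilbertModuleFrames.StdModule.ext fun i => Subsingleton.elim _ _⟩
    · have := hx.infinite
      obtain ⟨σ⟩ := nonempty_equiv_of_countable (α := J) (β := ℕ)
      obtain ⟨_, _, _, _, hs⟩ := hx
      exact HilbertModuleFrames.exists_isOrthonormalBasis_add_add σ x hD.1 (fun y => (hs y).1)
        hD.2 hc
  have hsq : 0 < √D := Real.sqrt_pos.2 hD.1
  have h1 : √D < √D * (1 + ε) := lt_mul_of_one_lt_right hsq (by linarith)
  refine ⟨key _ h1, fun h => key _ (h1.trans_le ?_)⟩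
  gcongr
  exact Real.sqrt_le_iff.2 ⟨hD.1.le, le_self_pow₀ h two_ne_zero⟩
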